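/- **Setting.** Let $N\in\mathbb N$. Let $H_k$ be the classical Hermite polynomials and $\varphi_k(x)=\pi^{-1/4}(2^kk!)^{-1/2}H_k(x)e^{-x^2/2}$ the univariate Hermite functions. For $S>0$ let $\varphi^S_{\mathbf k}(x)=\prod_{l=1}^N S^{1/2}\varphi_{k_l}(Sx_l)$, $\mathbf k\in\mathbb N^N$, be the $L^2(\mathbb R^N)$-orthonormal tensor-product Hermite basis stretched by $S$ ($S=1$ is the unscaled basis). For $K\ge 1$ let $$\mathcal K=\mathcal K(K)=\Big\{\mathbf k\in\mathbb N^N:\ \prod_{l=1}^N(1+k_l)\le K+1\Big\}$$ be the hyperbolically reduced index set, and let $X^{(l)}_{\mathcal K}=\big((\varphi^S_{\mathbf j},x_l\varphi^S_{\mathbf k})_{L^2}\big)_{\mathbf j,\mathbf k\in\mathcal K}$, $1\le l\le N$, be the coordinate matrices over $\mathcal K$. Let $L>0$, let $\mathcal R\subset\mathbb N^N$ be finite, and let $$W^{\mathrm{pol}}(x,t)=\sum_{\mathbf r\in\mathcal R}\alpha_{\mathbf r}(t)\prod_{l=1}^N T_{r_l}(x_l/L)$$ with Chebyshev polynomials $T_r$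 of the first kind and real coefficients $\alpha_{\mathbf r}(t)$; these are arbitrary, for example those of the Chebyshev interpolation polynomial over $\mathcal R$ of a potential $W(\cdot,t)$ on $[-L,L]^N$. Put $$W^{\mathrm{pol}}(X_{\mathcal K},t)=\sum_{\mathbf r\in\mathcal R}\alpha_{\mathbf r}(t)\,T_{r_1}\big(\tfrac1LX^{(1)}_{\mathcal K}\big)\cdots T_{r_N}\big(\tfrac1LX^{(N)}_{\mathcal K}\big).$$ Let $\mathcal W^{\mathrm{GH}(K)}_{\mathcal K,\mathrm{pol}}(t)$ be the Galerkin matrix of $W^{\mathrm{pol}}(\cdot,t)$ over $\mathcal K$ with all entries computed by the full product Gauss–Hermite quadrature with $K+1$ nodes per direction: $$\big(\mathcal W^{\mathrm{GH}(K)}_{\mathcal K,\mathrm{pol}}(t)\big)_{\mathbf j\mathbf k}=\sum_{\mathbf m\in\{0,\dots,K\}^N}\omega_{\mathbf m}\,\varphi_{\mathbf j}(\xi_{\mathbf m})\,W^{\mathrm{pol}}(\xi_{\mathbf m}/S,t)\,\varphi_{\mathbf k}(\xi_{\mathbf m}),\qquad \mathbf j,\mathbf k\in\mathcal K,$$ where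 $\varphi_{\mathbf k}=\varphi^1_{\mathbf k}$, $\xi_{\mathbf m}=(\xi_{m_1},\dots,\xi_{m_N})$, $\omega_{\mathbf m}=\prod_{l}w_{m_l}e^{\xi_{m_l}^2}$, and $\xi_0,\dots,\xi_K$ and $w_0,\dots,w_K$ are the zeros of $H_{K+1}$ and the corresponding Gauss–Hermite weights. (Multiplying $v$ by this matrix is the same as padding $v$ with zeros to a vector over $\{0,\dots,K\}^N$, applying the full Gauss–Hermite Galerkin matrix, and keeping the components in $\mathcal K$.) **Theorem.** For every $N$ there is a constant $c_N>0$, depending only on $N$, such that the following holds. Let $\beta\in\mathbb N$, let $\mathcal R$, $\alpha_{\mathbf r}$, $L>0$ and $t\in\mathbb R$ be as above, and set $$C(N,\mathcal R,W,\beta,L,t)=c_N\sum_{\mathbf r\in\mathcal R}|\alpha_{\mathbf r}(t)|\,2^{(\beta-2)N}\prod_{l=1}^N\left\{\binom{r_l}{\max(\lfloor r_l/2\rfloor-1,\,0)}\,2^{r_l/2}\,(r_l+1)^{\beta+3}\right\}.$$ Then for all $K\ge1$ and $S>0$ with $SL\ge\sqrt{2(K+1)}+1$, and for every $v\in\mathbb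 C^{\mathcal K}$ with componentwise decay $$|v_{\mathbf k}|\le A\prod_{l=1}^N\max(k_l,1)^{-\beta},\qquad \mathbf k\in\mathcal K,$$ the error due to index set reduction satisfies $$\left|\Big(\big(W^{\mathrm{pol}}(X_{\mathcal K},t)-\mathcal W^{\mathrm{GH}(K)}_{\mathcal K,\mathrm{pol}}(t)\big)v\Big)_{\mathbf j}\right|\le A\;C(N,\mathcal R,W,\beta,L,t)\;K^{-\beta},\qquad \mathbf j\in\mathcal K.$$ -/

import Mathlib

open scoped BigOperators

noncomputable section

namespace HermiteGalerkin

/-! ### Hermite functions -/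

/-- The classical (physicists') Hermite polynomials `H_k`. -/
def hermiteH : ℕ → Polynomial ℝ
  | 0 => 1
  | 1 => 2 * Polynomial.X
  | (k + 2) => 2 * Polynomial.X * hermiteH (k + 1) - (2 * ((k : ℝ) + 1)) • hermiteH k

/-- The univariate Hermite functions
`φ_k(x) = π^{-1/4} (2^k k!)^{-1/2} H_k(x) e^{-x²/2}`. -/
def phi (k : ℕ) (x : ℝ) : ℝ :=
  Real.pi ^ (-(1 / 4) : ℝ) * (Real.sqrt (2 ^ k * (k.factorial : ℝ)))⁻¹ *
    (hermiteH k).eval x * Real.exp (-x ^ 2 / 2)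

/-- The tensor-product Hermite functions, stretched by `S > 0` and normalised in `L²(ℝ^N)`:
`φ_k(x) = ∏ l, S^{1/2} φ_{k_l}(S x_l)`. -/
def phiN {N : ℕ} (S : ℝ) (k : Fin N → ℕ) (x : Fin N → ℝ) : ℝ :=
  ∏ l, (Real.sqrt S * phi (k l) (S * x l))

/-! ### Index sets -/

/-- The full index set `{k ∈ ℕ^N | k_l ≤ K}`. -/
def fullSet (N K : ℕ) : Finset (Fin N → ℕ) :=
  Fintype.piFinset fun _ => Finset.range (K + 1)

/-- The hyperbolically reduced index set `{k ∈ ℕ^N | ∏ l, (1 + k_l) ≤ K + 1}`. -/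
def hypSet (N K : ℕ) : Finset (Fin N → ℕ) :=
  (fullSet N K).filter fun k => ∏ l, (1 + k l) ≤ K + 1

theorem mem_hypSet {N K : ℕ} {k : Fin N → ℕ} :
    k ∈ hypSet N K ↔ ∏ l, (1 + k l) ≤ K + 1 := by
  constructor
  · intro h
    exact (Finset.mem_filter.mp h).2
  · intro h
    refine Finset.mem_filter.mpr ⟨Fintype.mem_piFinset.mpr fun l => ?_, h⟩
    have h1 : 1 + k l ≤ ∏ i, (1 + k i) :=
      Finset.single_le_prod' (f := fun i => 1 + k i) (fun i _ => by omega) (Finset.mem_univ l)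
    exact Finset.mem_range.mpr (by omega)

/-! ### Coordinate matrices and their insertion into a polynomial -/

/-- The `l`-th coordinate matrix over the index set `I`:
`(X^{(l)})_{jk} = (φ_j, q_l φ_k)`, with `q_l` the multiplication by `x_l`. -/
def coordMatrix {N : ℕ} (S : ℝ) (I : Finset (Fin N → ℕ)) (l : Fin N) : Matrix I I ℝ :=
  fun j k => ∫ x : Fin N → ℝ, phiN S j.1 x * (x l * phiN S k.1 x)

/-- The polynomial `W^pol(x) = ∑ r ∈ 𝓡, α_r ∏ l, T_{r_l}(x_l / L)`. -/
def Wpol {N : ℕ} (𝓡 : Finset (Fin N → ℕ)) (α : (Fin N → ℕ) → ℝ) (L : ℝ)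
    (x : Fin N → ℝ) : ℝ :=
  ∑ r ∈ 𝓡, α r * ∏ l, (Polynomial.Chebyshev.T ℝ (r l : ℤ)).eval (x l / L)

/-- Formal insertion of the coordinate matrices over `I` into `W^pol`:
`∑ r ∈ 𝓡, α_r T_{r_1}(X^{(1)} / L) ⋯ T_{r_N}(X^{(N)} / L)`, the factors in this order. -/
def WpolInsert {N : ℕ} (𝓡 : Finset (Fin N → ℕ)) (α : (Fin N → ℕ) → ℝ) (L S : ℝ)
    (I : Finset (Fin N → ℕ)) : Matrix I I ℝ :=
  ∑ r ∈ 𝓡, α r •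
    (List.ofFn fun l : Fin N =>
      Polynomial.aeval (L⁻¹ • coordMatrix S I l) (Polynomial.Chebyshev.T ℝ (r l : ℤ))).prod

/-! ### Gauss-Hermite quadrature -/

/-- The nodes of the Gauss-Hermite formula with parameter `M`: the zeros of `H_{M+1}`. -/
def ghNodes (M : ℕ) : Finset ℝ := (hermiteH (M + 1)).roots.toFinset

/-- The Gauss-Hermite weight at the node `ξ`: the integral of the Lagrange basis polynomial
belonging to `ξ` against `e^{-x²}`. -/
def ghWeight (M : ℕ) (ξ : ℝ) : ℝ :=
  ∫ x : ℝ, (Lagrange.basis (ghNodes M) id ξ).eval x * Real.exp (-x ^ 2)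

/-- The Galerkin matrix of `W^pol` over `I` in the basis `phiN S`, each entry approximated by the
full product Gauss-Hermite formula with `M + 1` nodes per direction (after the substitution
`y = S x`; for `S = 1` the entry is
`∑ m, ω_m φ_j(ξ_m) W^pol(ξ_m) φ_k(ξ_m)` with `ω_m = ∏ l, w_{m_l} e^{ξ_{m_l}²}`). -/
def ghMatrix {N : ℕ} (𝓡 : Finset (Fin N → ℕ)) (α : (Fin N → ℕ) → ℝ) (L S : ℝ) (M : ℕ)
    (I : Finset (Fin N → ℕ)) : Matrix I I ℝ :=
  fun j k => ∑ ξ ∈ Fintype.piFinset fun _ : Fin N => ghNodes M,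
    (∏ l, ghWeight M (ξ l) * Real.exp (ξ l ^ 2)) *
      (∏ l, phi (j.1 l) (ξ l)) * Wpol 𝓡 α L (fun l => ξ l / S) * ∏ l, phi (k.1 l) (ξ l)

/-! ### The constant -/

/-- `∑ r ∈ 𝓡, |α_r| 2^{(β-2)N} ∏ l, binom(r_l, ⌊r_l/2 - 1⌋₊) 2^{r_l/2} (r_l+1)^{β+3}`.
The subtraction in the binomial coefficient is truncated on purpose. -/
def redConst {N : ℕ} (β : ℕ) (𝓡 : Finset (Fin N → ℕ)) (α : (Fin N → ℕ) → ℝ) : ℝ :=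
  ∑ r ∈ 𝓡, |α r| * (2 : ℝ) ^ (((β : ℤ) - 2) * (N : ℤ)) *
    ∏ l, (((r l).choose (r l / 2 - 1) : ℝ) * Real.sqrt 2 ^ (r l) *
      ((r l : ℝ) + 1) ^ (β + 3))

end HermiteGalerkin

end

open scoped BigOperators

noncomputable section

namespace HermiteGalerkin

open Polynomial MeasureTheory

/-! ### Hermite polynomials and Gaussian moments -/

/-! By linearity it suffices to treat one product `∏ l, T_{r_l}(x_l / L)`. Let `D` be the insertion
over the hyperbolic set minus the quadrature matrix.

Evaluate all basis functions of an index set at a node tuple `ξ` to get a row vector. The three-term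
recurrence makes it a left eigenvector of each coordinate matrix, with eigenvalue `ξ l / S`, in
every column whose upward neighbour stays in the set or has a function vanishing at `ξ`. As long as
the steps counted by `r` meet only such columns, inserting matrices is multiplying by the polynomial
at the nodes, and discrete orthonormality turns this into equality with the quadrature
(`chebyshevQuadrature_eq`). Over the full box this always applies, because `φ_{K+1}` vanishes at the
nodes. Over the hyperbolic set it applies to column `k` if the whole box below `k + r` lies in the
set.

Hence the quadrature entries are entries of an insertion over the full box, and three facts control
`D`. Both parts have bandwidth `r`, so each row meets at most `∏ 2(r_l + 1)` columns. Each insertion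
is a product of contractions (Gershgorin puts the spectra of the scaled coordinate matrices in `[-1,
1]`, where `|T_n| ≤ 1`), so `|D j k| ≤ 2`. Finally `D j k = 0` unless `∏ (1 + k_l + r_l) > K + 1`,
and there the decay of `v` yields `K^{-β} ∏ (r_l + 2)^β`. Multiplying the three bounds gives the
theorem.

The quadrature facts need `M + 1` distinct real zeros of `H_{M+1}`; they are obtained as eigenvalues
of the leading Jacobi block. -/

/-- The two identities feed each other: the derivative formula turns the defining recurrence into
the first identity, which in turn is needed to differentiate the next polynomial. Hence the joint
induction. -/
theorem hermiteH_succ_and_derivative (k : ℕ) :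
    hermiteH (k + 1) = 2 * X * hermiteH k - derivative (hermiteH k) ∧
      derivative (hermiteH (k + 1)) = (2 * ((k : ℝ) + 1)) • hermiteH k := by
  induction k with
  | zero =>
    constructor
    · simp [hermiteH]
    · simp only [hermiteH, smul_eq_C_mul, derivative_mul, derivative_X, derivative_ofNat]
      simp [show (C 2 : ℝ[X]) = 2 from rfl]
  | succ k ih =>
    obtain ⟨h1, h2⟩ := ih
    have h3 : hermiteH (k + 1 + 1) = 2 * X * hermiteH (k + 1) - derivative (hermiteH (k + 1)) := by
      rw [h2, hermiteH]
    refine ⟨h3, ?_⟩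
    rw [hermiteH]
    have h4 : derivative (hermiteH k) = 2 * X * hermiteH k - hermiteH (k + 1) := by
      rw [h1]; ring
    simp only [derivative_sub, derivative_mul, derivative_X, derivative_ofNat, derivative_smul,
      h2, h4]
    simp only [smul_eq_C_mul, C_mul, C_add, map_natCast, C_1, Nat.cast_add, Nat.cast_one,
      show (C 2 : ℝ[X]) = 2 from rfl]
    ring

theorem hermiteH_succ (k : ℕ) :
    hermiteH (k + 1) = 2 * X * hermiteH k - derivative (hermiteH k) :=
  (hermiteH_succ_and_derivative k).1

theorem derivative_hermiteH_succ (k : ℕ) :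
    derivative (hermiteH (k + 1)) = (2 * ((k : ℝ) + 1)) • hermiteH k :=
  (hermiteH_succ_and_derivative k).2

theorem degree_hermiteH (k : ℕ) : (hermiteH k).degree = k := by
  induction k with
  | zero => simp [hermiteH]
  | succ k ih =>
    have h0 : hermiteH k ≠ 0 := by
      rintro h
      simp [h] at ih
    have h2 : (2 * X * hermiteH k).degree = ((k + 1 : ℕ) : WithBot ℕ) := by
      have : (2 : ℝ[X]) = C 2 := rfl
      rw [degree_mul, degree_mul, ih, this, degree_C two_ne_zero, degree_X]
      push_cast
      rw [zero_add, add_comm]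
    rw [hermiteH_succ, degree_sub_eq_left_of_degree_lt, h2]
    rw [h2]
    refine (degree_derivative_lt h0).trans ?_
    rw [ih]
    exact_mod_cast Nat.lt_succ_self k

theorem hermiteH_ne_zero (k : ℕ) : hermiteH k ≠ 0 := by
  intro h
  simpa [h] using degree_hermiteH k

theorem natDegree_hermiteH (k : ℕ) : (hermiteH k).natDegree = k :=
  natDegree_eq_of_degree_eq_some (degree_hermiteH k)

theorem integrable_eval_mul_exp (p : ℝ[X]) :
    Integrable fun x : ℝ => p.eval x * Real.exp (-x ^ 2) := by
  induction p using Polynomial.induction_on' with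
  | add p q hp hq =>
    simp only [eval_add, add_mul]
    exact hp.add hq
  | monomial n a =>
    have h := integrable_rpow_mul_exp_neg_mul_sq (b := 1) one_pos (s := n)
      (by have : (0 : ℝ) ≤ n := n.cast_nonneg
          linarith)
    simp only [Real.rpow_natCast, neg_mul, one_mul] at h
    simpa [mul_assoc] using h.const_mul a

/-- Integration of polynomials against the weight `e^{-x²}`. -/
def gaussInt : ℝ[X] →ₗ[ℝ] ℝ where
  toFun p := ∫ x : ℝ, p.eval x * Real.exp (-x ^ 2)
  map_add' p q := by
    simp only [eval_add, add_mul]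
    exact integral_add (integrable_eval_mul_exp p) (integrable_eval_mul_exp q)
  map_smul' a p := by
    simp only [eval_smul, smul_eq_mul, mul_assoc, RingHom.id_apply]
    exact integral_const_mul _ _

theorem gaussInt_apply (p : ℝ[X]) : gaussInt p = ∫ x : ℝ, p.eval x * Real.exp (-x ^ 2) := rfl

/-- Integration by parts: the derivative of `p e^{-x²}` integrates to zero. -/
theorem gaussInt_derivative (p : ℝ[X]) : gaussInt (derivative p) = gaussInt (2 * X * p) := by
  rw [← sub_eq_zero, ← map_sub, gaussInt_apply]
  refine integral_eq_zero_of_hasDerivAt_of_integrable (f := fun x => p.eval x * Real.exp (-x ^ 2))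
    (fun x => ?_) (integrable_eval_mul_exp _) (integrable_eval_mul_exp _)
  have h := (p.hasDerivAt x).mul (((hasDerivAt_id x).pow 2).neg.exp)
  refine h.congr_deriv ?_
  simp
  ring

theorem gaussInt_mul_hermiteH_succ (p : ℝ[X]) (k : ℕ) :
    gaussInt (p * hermiteH (k + 1)) = gaussInt (derivative p * hermiteH k) := by
  have h := gaussInt_derivative (p * hermiteH k)
  rw [derivative_mul, map_add] at h
  rw [hermiteH_succ, mul_sub, map_sub, sub_eq_iff_eq_add, h]
  congr 1
  ring

theorem gaussInt_mul_hermiteH (p : ℝ[X]) (k : ℕ) :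
    gaussInt (p * hermiteH k) = gaussInt (derivative^[k] p) := by
  induction k generalizing p with
  | zero => simp [hermiteH]
  | succ k ih => rw [gaussInt_mul_hermiteH_succ, ih, Function.iterate_succ_apply]

theorem gaussInt_mul_hermiteH_eq_zero {p : ℝ[X]} {k : ℕ} (h : p.natDegree < k) :
    gaussInt (p * hermiteH k) = 0 := by
  rw [gaussInt_mul_hermiteH, iterate_derivative_eq_zero h, map_zero]

theorem gaussInt_hermiteH_self (k : ℕ) :
    gaussInt (hermiteH k * hermiteH k) = 2 ^ k * (k.factorial : ℝ) * Real.sqrt Real.pi := by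
  induction k with
  | zero =>
    have := integral_gaussian 1
    simp only [neg_mul, one_mul, div_one] at this
    simp [hermiteH, gaussInt_apply, this]
  | succ k ih =>
    rw [gaussInt_mul_hermiteH_succ, derivative_hermiteH_succ, smul_mul_assoc, map_smul, ih,
      Nat.factorial_succ]
    push_cast
    rw [smul_eq_mul]
    ring

theorem gaussInt_hermiteH_mul (j k : ℕ) : gaussInt (hermiteH j * hermiteH k) =
    if j = k then 2 ^ k * (k.factorial : ℝ) * Real.sqrt Real.pi else 0 := by
  split_ifs with h
  · rw [h, gaussInt_hermiteH_self]
  · rcases lt_or_gt_of_ne h with h | h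
    · exact gaussInt_mul_hermiteH_eq_zero (by rwa [natDegree_hermiteH])
    · rw [mul_comm]
      exact gaussInt_mul_hermiteH_eq_zero (by rwa [natDegree_hermiteH])

/-! ### Normalised Hermite polynomials -/

/-- The orthonormal Hermite polynomials `p_k`, so that `φ_k(x) = p_k(x) e^{-x²/2}`. -/
def hermiteNormalized (k : ℕ) : ℝ[X] :=
  (Real.pi ^ (-(1 / 4) : ℝ) * (Real.sqrt (2 ^ k * (k.factorial : ℝ)))⁻¹) • hermiteH k

theorem phi_eq (k : ℕ) (x : ℝ) :
    phi k x = (hermiteNormalized k).eval x * Real.exp (-x ^ 2 / 2) := by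
  rw [phi, hermiteNormalized, eval_smul, smul_eq_mul]

theorem normalization_ne_zero (k : ℕ) :
    Real.pi ^ (-(1 / 4) : ℝ) * (Real.sqrt (2 ^ k * (k.factorial : ℝ)))⁻¹ ≠ 0 := by
  have := Real.pi_pos
  positivity

theorem degree_hermiteNormalized (k : ℕ) : (hermiteNormalized k).degree = k := by
  rw [hermiteNormalized, smul_eq_C_mul, degree_C_mul (normalization_ne_zero k), degree_hermiteH]

theorem natDegree_hermiteNormalized (k : ℕ) : (hermiteNormalized k).natDegree = k :=
  natDegree_eq_of_degree_eq_some (degree_hermiteNormalized k)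

theorem hermiteNormalized_zero_eval_ne_zero (x : ℝ) : (hermiteNormalized 0).eval x ≠ 0 := by
  have := Real.pi_pos
  have h : Real.pi ^ (-(1 / 4) : ℝ) ≠ 0 := by positivity
  simpa [hermiteNormalized, hermiteH] using h

theorem eval_hermiteNormalized_eq_zero_iff {k : ℕ} {x : ℝ} :
    (hermiteNormalized k).eval x = 0 ↔ (hermiteH k).eval x = 0 := by
  rw [hermiteNormalized, eval_smul, smul_eq_mul, mul_eq_zero]
  simp only [normalization_ne_zero k, false_or]

theorem gaussInt_hermiteNormalized_mul (j k : ℕ) :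
    gaussInt (hermiteNormalized j * hermiteNormalized k) = if j = k then 1 else 0 := by
  rw [hermiteNormalized, hermiteNormalized, smul_mul_smul_comm, map_smul, gaussInt_hermiteH_mul]
  split_ifs with h
  · subst h
    have hs : (0 : ℝ) < 2 ^ j * (j.factorial : ℝ) := by positivity
    have hpi : (Real.pi ^ (-(1 / 4) : ℝ)) * (Real.pi ^ (-(1 / 4) : ℝ)) * Real.sqrt Real.pi = 1 := by
      rw [Real.sqrt_eq_rpow, ← Real.rpow_add Real.pi_pos, ← Real.rpow_add Real.pi_pos]
      norm_num
    have hss := Real.mul_self_sqrt hs.le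
    set s := Real.sqrt (2 ^ j * (j.factorial : ℝ)) with hsdef
    have hs0 : s ≠ 0 := (Real.sqrt_pos.mpr hs).ne'
    rw [← hss, smul_eq_mul]
    calc _ = (Real.pi ^ (-(1 / 4) : ℝ)) * (Real.pi ^ (-(1 / 4) : ℝ)) * Real.sqrt Real.pi
          * (s⁻¹ * s) * (s⁻¹ * s) := by ring
      _ = 1 := by rw [hpi, inv_mul_cancel₀ hs0]; norm_num
  · simp

/-- At `k = 0` the truncated index `k - 1 = 0` is harmless, since its coefficient `√(k/2)` vanishes.
-/
theorem eval_mul_hermiteNormalized (k : ℕ) (x : ℝ) :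
    x * (hermiteNormalized k).eval x =
      Real.sqrt (((k : ℝ) + 1) / 2) * (hermiteNormalized (k + 1)).eval x +
        Real.sqrt ((k : ℝ) / 2) * (hermiteNormalized (k - 1)).eval x := by
  have step (n : ℕ) : Real.sqrt (2 ^ (n + 1) * ((n + 1).factorial : ℝ)) =
      2 * Real.sqrt (((n : ℝ) + 1) / 2) * Real.sqrt (2 ^ n * (n.factorial : ℝ)) := by
    have : (2 : ℝ) = Real.sqrt 4 := by
      rw [show (4 : ℝ) = 2 ^ 2 by norm_num, Real.sqrt_sq (by norm_num)]
    nth_rewrite 2 [this]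
    rw [← Real.sqrt_mul (by norm_num), ← Real.sqrt_mul (by positivity), Nat.factorial_succ]
    congr 1
    push_cast
    ring
  have pos (n : ℕ) : Real.sqrt (2 ^ n * (n.factorial : ℝ)) ≠ 0 := by positivity
  have pos' (n : ℕ) : Real.sqrt (((n : ℝ) + 1) / 2) ≠ 0 := by positivity
  cases k with
  | zero =>
    have h0 := pos' 0
    simp only [hermiteNormalized, eval_smul, smul_eq_mul]
    rw [step]
    simp only [hermiteH, eval_mul, eval_X, eval_one, eval_ofNat, Nat.cast_zero, zero_div,
      Real.sqrt_zero, zero_mul, add_zero]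
    have h1 := pos 0
    field_simp
  | succ n =>
    simp only [hermiteNormalized, eval_smul, smul_eq_mul, Nat.add_sub_cancel]
    rw [step (n + 1), step n]
    have h1 := pos n
    have h2 := pos' n
    have h3 := pos' (n + 1)
    have h4 : Real.sqrt (((n : ℝ) + 1) / 2) * Real.sqrt (((n : ℝ) + 1) / 2) = ((n : ℝ) + 1) / 2 :=
      Real.mul_self_sqrt (by positivity)
    have h5 : (hermiteH (n + 1 + 1)).eval x =
        2 * x * (hermiteH (n + 1)).eval x - 2 * ((n : ℝ) + 1) * (hermiteH n).eval x := by
      rw [hermiteH]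
      simp
    rw [h5]
    push_cast at h3 ⊢
    set s := Real.sqrt (((n : ℝ) + 1) / 2)
    set t := Real.sqrt (((n : ℝ) + 1 + 1) / 2)
    set u := Real.sqrt (2 ^ n * (n.factorial : ℝ))
    have h6 : (n : ℝ) + 1 = 2 * (s * s) := by rw [h4]; ring
    rw [h6]
    field_simp
    ring

/-! ### The Jacobi matrix of the Hermite polynomials -/

/-- The entries of the Jacobi matrix `(φ_a, x φ_b)` of the Hermite functions. -/
def jacobi (a b : ℕ) : ℝ :=
  (if a = b + 1 then Real.sqrt (((b : ℝ) + 1) / 2) else 0) +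
    if a + 1 = b then Real.sqrt ((b : ℝ) / 2) else 0

theorem jacobi_comm (a b : ℕ) : jacobi a b = jacobi b a := by
  unfold jacobi
  rw [add_comm]
  congr 1
  · by_cases h : a + 1 = b
    · subst h; simp
    · simp [h, Ne.symm h]
  · by_cases h : a = b + 1
    · subst h; simp
    · simp [h, Ne.symm h]

theorem jacobi_nonneg (a b : ℕ) : 0 ≤ jacobi a b := by
  unfold jacobi
  positivity

theorem le_of_jacobi_ne_zero {a b : ℕ} (h : jacobi a b ≠ 0) : a ≤ b + 1 := by
  by_contra hlt
  exact h (by rw [jacobi, if_neg (by omega), if_neg (by omega), add_zero])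

theorem sum_jacobi_mul (s : Finset ℕ) (b : ℕ) (f : ℕ → ℝ) :
    ∑ a ∈ s, jacobi a b * f a =
      Real.sqrt (((b : ℝ) + 1) / 2) * (if b + 1 ∈ s then f (b + 1) else 0) +
        Real.sqrt ((b : ℝ) / 2) * (if b - 1 ∈ s then f (b - 1) else 0) := by
  simp only [jacobi, add_mul, Finset.sum_add_distrib, ite_mul, zero_mul, mul_ite, mul_zero]
  congr 1
  · rw [Finset.sum_ite_eq']
  · cases b with
    | zero => simp
    | succ b =>
      simp only [Nat.add_right_cancel_iff, Nat.add_sub_cancel]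
      rw [Finset.sum_ite_eq']

/-- A column has at most two nonzero entries, each at most `√((K+1)/2)`. -/
theorem sum_jacobi_le {s : Finset ℕ} {b K : ℕ} (hb : b ≤ K) :
    ∑ a ∈ s, jacobi a b ≤ Real.sqrt (2 * ((K : ℝ) + 1)) := by
  have h := sum_jacobi_mul s b fun _ => 1
  simp only [mul_one] at h
  have hb' : (b : ℝ) ≤ K := by exact_mod_cast hb
  have h1 : Real.sqrt (((b : ℝ) + 1) / 2) ≤ Real.sqrt (((K : ℝ) + 1) / 2) :=
    Real.sqrt_le_sqrt (by linarith)
  have h2 : Real.sqrt ((b : ℝ) / 2) ≤ Real.sqrt (((K : ℝ) + 1) / 2) :=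
    Real.sqrt_le_sqrt (by linarith)
  have h3 : Real.sqrt (2 * ((K : ℝ) + 1)) = 2 * Real.sqrt (((K : ℝ) + 1) / 2) := by
    rw [show 2 * ((K : ℝ) + 1) = 2 ^ 2 * (((K : ℝ) + 1) / 2) by ring,
      Real.sqrt_mul (by norm_num), Real.sqrt_sq (by norm_num)]
  have h4 : ∀ (q : Prop) [Decidable q] (t : ℝ), 0 ≤ t → t * (if q then 1 else 0) ≤ t := by
    intro q _ t ht
    split_ifs <;> simp [ht]
  rw [h, h3]
  linarith [h4 (b + 1 ∈ s) _ (Real.sqrt_nonneg (((b : ℝ) + 1) / 2)),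
    h4 (b - 1 ∈ s) _ (Real.sqrt_nonneg ((b : ℝ) / 2))]

/-- The coefficient of `f (k + 1)` is nonzero, so the recurrence has only one solution up to
scaling. Cross-multiplying by the nonzero value of `p_0` avoids a division. -/
theorem eq_mul_hermiteNormalized_of_recurrence {f : ℕ → ℝ} {x : ℝ} {n : ℕ}
    (hf : ∀ k < n, x * f k =
      Real.sqrt (((k : ℝ) + 1) / 2) * f (k + 1) + Real.sqrt ((k : ℝ) / 2) * f (k - 1)) :
    ∀ k ≤ n, f k * (hermiteNormalized 0).eval x = f 0 * (hermiteNormalized k).eval x := by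
  intro k
  induction k using Nat.strong_induction_on with
  | _ k ih =>
    intro hk
    cases k with
    | zero => rfl
    | succ k =>
      have e1 := hf k hk
      have e2 := eval_mul_hermiteNormalized k x
      have i1 := ih k (Nat.lt_succ_self k) (by omega)
      have i2 := ih (k - 1) (by omega) (by omega)
      have h0 : Real.sqrt (((k : ℝ) + 1) / 2) ≠ 0 := by positivity
      refine mul_left_cancel₀ h0 ?_
      linear_combination (-(hermiteNormalized 0).eval x) * e1 + f 0 * e2 + x * i1
        - Real.sqrt ((k : ℝ) / 2) * i2

/-- The leading `n × n` block of the Jacobi matrix. -/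
def jacobiMatrix (n : ℕ) : Matrix (Fin n) (Fin n) ℝ := Matrix.of fun a b => jacobi a b

theorem isHermitian_jacobiMatrix (n : ℕ) : (jacobiMatrix n).IsHermitian := by
  ext a b
  simp [jacobiMatrix, jacobi_comm]

/-- Extended by zero, an eigenvector satisfies the full recurrence for all indices below `n`, so it
is a multiple of `(p_0(x), p_1(x), …)`. Its vanishing value at `n` makes the eigenvalue `x` a zero
of `p_n` once the first component is known to be nonzero. -/
theorem eigenvectorBasis_jacobiMatrix {n : ℕ} (hn : 0 < n) (i a : Fin n) :
    (isHermitian_jacobiMatrix n).eigenvectorBasis i a *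
        (hermiteNormalized 0).eval ((isHermitian_jacobiMatrix n).eigenvalues i) =
      (isHermitian_jacobiMatrix n).eigenvectorBasis i ⟨0, hn⟩ *
        (hermiteNormalized a).eval ((isHermitian_jacobiMatrix n).eigenvalues i) ∧
    (isHermitian_jacobiMatrix n).eigenvectorBasis i ⟨0, hn⟩ *
        (hermiteNormalized n).eval ((isHermitian_jacobiMatrix n).eigenvalues i) = 0 := by
  set hJ := isHermitian_jacobiMatrix n
  set x := hJ.eigenvalues i with hx
  set f : ℕ → ℝ := fun a => if h : a < n then hJ.eigenvectorBasis i ⟨a, h⟩ else 0 with hfdef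
  have hfa (a : Fin n) : f a = hJ.eigenvectorBasis i a := by simp [hfdef]
  have hrec : ∀ k < n, x * f k =
      Real.sqrt (((k : ℝ) + 1) / 2) * f (k + 1) + Real.sqrt ((k : ℝ) / 2) * f (k - 1) := by
    intro k hk
    have h := congrFun (hJ.mulVec_eigenvectorBasis i) ⟨k, hk⟩
    rw [Pi.smul_apply, smul_eq_mul, ← hx, ← hfa ⟨k, hk⟩] at h
    rw [← h, Matrix.mulVec, dotProduct]
    have h2 : ∑ a : Fin n, jacobiMatrix n ⟨k, hk⟩ a * hJ.eigenvectorBasis i a =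
        ∑ a ∈ Finset.range n, jacobi a k * f a := by
      rw [← Fin.sum_univ_eq_sum_range (fun a => jacobi a k * f a) n]
      refine Finset.sum_congr rfl fun a _ => ?_
      rw [hfa, jacobi_comm]
      rfl
    rw [h2, sum_jacobi_mul]
    congr 2
    · by_cases h3 : k + 1 < n <;> simp [hfdef, h3]
    · rw [if_pos (Finset.mem_range.mpr (by omega))]
  have hmain := eq_mul_hermiteNormalized_of_recurrence hrec
  constructor
  · have := hmain a a.2.le
    rwa [hfa, ← hfa ⟨0, hn⟩] at *
  · have := hmain n le_rfl
    have hfn : f n = 0 := by simp [hfdef]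
    rw [hfn, zero_mul] at this
    rw [← hfa ⟨0, hn⟩]
    exact this.symm

theorem eigenvectorBasis_jacobiMatrix_zero_ne_zero {n : ℕ} (hn : 0 < n) (i : Fin n) :
    (isHermitian_jacobiMatrix n).eigenvectorBasis i ⟨0, hn⟩ ≠ 0 := by
  intro h
  have h0 : (isHermitian_jacobiMatrix n).eigenvectorBasis i = 0 := by
    ext a
    have := (eigenvectorBasis_jacobiMatrix hn i a).1
    rw [h, zero_mul] at this
    exact (mul_eq_zero.mp this).resolve_right (hermiteNormalized_zero_eval_ne_zero _)
  have h1 := (isHermitian_jacobiMatrix n).eigenvectorBasis.orthonormal.1 i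
  simp [h0] at h1

/-- Two eigenvectors with the same eigenvalue would be proportional, yet they are orthogonal and
have nonzero first components. -/
theorem injective_eigenvalues_jacobiMatrix (n : ℕ) :
    Function.Injective (isHermitian_jacobiMatrix n).eigenvalues := by
  intro i j hij
  by_contra hne
  have hn : 0 < n := i.pos
  set B := (isHermitian_jacobiMatrix n).eigenvectorBasis
  have h : (B i ⟨0, hn⟩) • B j = (B j ⟨0, hn⟩) • B i := by
    ext a
    have h1 := (eigenvectorBasis_jacobiMatrix hn i a).1
    have h2 := (eigenvectorBasis_jacobiMatrix hn j a).1
    rw [← hij] at h2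
    refine mul_right_cancel₀ (hermiteNormalized_zero_eval_ne_zero
      ((isHermitian_jacobiMatrix n).eigenvalues i)) ?_
    simp only [PiLp.smul_apply, smul_eq_mul]
    linear_combination (B i ⟨0, hn⟩) * h2 - (B j ⟨0, hn⟩) * h1
  have h3 := congrArg (fun v => inner ℝ (B i) v) h
  simp only [inner_smul_right, B.orthonormal.2 hne, mul_zero, real_inner_self_eq_norm_sq,
    B.orthonormal.1 i] at h3
  exact eigenvectorBasis_jacobiMatrix_zero_ne_zero hn j (by simpa using h3.symm)

/-! ### Gauss-Hermite quadrature -/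

theorem mem_ghNodes {M : ℕ} {x : ℝ} :
    x ∈ ghNodes M ↔ (hermiteNormalized (M + 1)).eval x = 0 := by
  rw [ghNodes, Multiset.mem_toFinset, mem_roots (hermiteH_ne_zero _), IsRoot,
    eval_hermiteNormalized_eq_zero_iff]

/-- The degree bounds the count from above; the `M + 1` distinct eigenvalues of the Jacobi block are
zeros and bound it from below. -/
theorem card_ghNodes (M : ℕ) : (ghNodes M).card = M + 1 := by
  apply le_antisymm
  · refine (Multiset.toFinset_card_le _).trans ((card_roots' _).trans_eq ?_)
    exact natDegree_hermiteH _
  · have h : Finset.univ.image (isHermitian_jacobiMatrix (M + 1)).eigenvalues ⊆ ghNodes M := by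
      intro x hx
      obtain ⟨i, -, rfl⟩ := Finset.mem_image.mp hx
      exact mem_ghNodes.mpr ((mul_eq_zero.mp (eigenvectorBasis_jacobiMatrix M.succ_pos i i).2
        ).resolve_left (eigenvectorBasis_jacobiMatrix_zero_ne_zero _ i))
    have h2 := Finset.card_le_card h
    rwa [Finset.card_image_of_injective _ (injective_eigenvalues_jacobiMatrix _),
      Finset.card_univ, Fintype.card_fin] at h2

theorem gaussInt_eq_sum_of_degree_lt {M : ℕ} {q : ℝ[X]} (hq : q.degree < (M + 1 : ℕ)) :
    gaussInt q = ∑ ξ ∈ ghNodes M, ghWeight M ξ * q.eval ξ := by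
  have h := Lagrange.eq_interpolate (s := ghNodes M) (v := (id : ℝ → ℝ)) (f := q)
    Function.injective_id.injOn (by rwa [card_ghNodes])
  conv_lhs => rw [h]
  rw [Lagrange.interpolate_apply, map_sum]
  refine Finset.sum_congr rfl fun ξ _ => ?_
  rw [← smul_eq_C_mul, map_smul, smul_eq_mul, mul_comm]
  rfl

/-- The Gauss-Hermite formula with `M + 1` nodes is exact for polynomials of degree at most
`2 M + 1`. -/
theorem gaussInt_eq_sum {M : ℕ} {q : ℝ[X]} (hq : q.natDegree < 2 * (M + 1)) :
    gaussInt q = ∑ ξ ∈ ghNodes M, ghWeight M ξ * q.eval ξ := by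
  set H := hermiteH (M + 1) with hH
  have hH0 : H ≠ 0 := hermiteH_ne_zero _
  have hdiv : H * (q / H) + q % H = q := EuclideanDomain.div_add_mod q H
  have hdeg : (q % H).degree < (M + 1 : ℕ) := by
    have := degree_mod_lt q hH0
    rwa [hH, degree_hermiteH] at this
  have hs : (q / H).natDegree < M + 1 := by
    by_cases hlt : q.degree < H.degree
    · rw [(Polynomial.div_eq_zero_iff hH0).mpr hlt, natDegree_zero]
      exact Nat.succ_pos M
    · have h0 : q / H ≠ 0 := fun h => hlt ((Polynomial.div_eq_zero_iff hH0).mp h)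
      have h : (H * (q / H)).natDegree = q.natDegree :=
        natDegree_eq_of_degree_eq (by rw [degree_mul, degree_add_div hH0 (not_lt.mp hlt)])
      rw [natDegree_mul hH0 h0, show H.natDegree = M + 1 from natDegree_hermiteH _] at h
      omega
  -- The quotient has degree below `M + 1`, so `H` is orthogonal to it; at the nodes `H` vanishes.
  -- Neither side sees more of `q` than its remainder.
  have h1 : gaussInt q = gaussInt (q % H) := by
    conv_lhs => rw [← hdiv]
    rw [map_add, mul_comm, hH, gaussInt_mul_hermiteH_eq_zero hs, zero_add]
  rw [h1, gaussInt_eq_sum_of_degree_lt hdeg]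
  refine Finset.sum_congr rfl fun ξ hξ => ?_
  have h2 : H.eval ξ = 0 := eval_hermiteNormalized_eq_zero_iff.mp (mem_ghNodes.mp hξ)
  have h3 := congrArg (eval ξ) hdiv
  rw [eval_add, eval_mul, h2, zero_mul, zero_add] at h3
  rw [h3]

theorem sum_ghWeight_mul_phi_mul_phi {M j k : ℕ} (hj : j ≤ M) (hk : k ≤ M) :
    ∑ ξ ∈ ghNodes M, ghWeight M ξ * Real.exp (ξ ^ 2) * (phi j ξ * phi k ξ) =
      if j = k then 1 else 0 := by
  rw [← gaussInt_hermiteNormalized_mul, gaussInt_eq_sum (M := M)]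
  · refine Finset.sum_congr rfl fun ξ _ => ?_
    rw [phi_eq, phi_eq, eval_mul]
    have : Real.exp (ξ ^ 2) * (Real.exp (-ξ ^ 2 / 2) * Real.exp (-ξ ^ 2 / 2)) = 1 := by
      rw [← Real.exp_add, ← Real.exp_add]
      ring_nf
      exact Real.exp_zero
    linear_combination (ghWeight M ξ * (hermiteNormalized j).eval ξ *
      (hermiteNormalized k).eval ξ) * this
  · refine natDegree_mul_le.trans_lt ?_
    rw [natDegree_hermiteNormalized, natDegree_hermiteNormalized]
    omega

/-! ### Hermite functions -/

theorem mul_phi (k : ℕ) (x : ℝ) :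
    x * phi k x = Real.sqrt (((k : ℝ) + 1) / 2) * phi (k + 1) x +
        Real.sqrt ((k : ℝ) / 2) * phi (k - 1) x := by
  simp only [phi_eq]
  linear_combination Real.exp (-x ^ 2 / 2) * eval_mul_hermiteNormalized k x

theorem phi_mul_phi (j k : ℕ) (x : ℝ) : phi j x * phi k x =
    (hermiteNormalized j * hermiteNormalized k).eval x * Real.exp (-x ^ 2) := by
  rw [phi_eq, phi_eq, eval_mul, show -x ^ 2 = -x ^ 2 / 2 + -x ^ 2 / 2 by ring, Real.exp_add]
  ring_nf

theorem integrable_phi_mul_phi (j k : ℕ) : Integrable fun x => phi j x * phi k x := by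
  simp only [phi_mul_phi]
  exact integrable_eval_mul_exp _

theorem integral_phi_mul_phi (j k : ℕ) : ∫ x, phi j x * phi k x = if j = k then 1 else 0 := by
  simp only [phi_mul_phi]
  exact gaussInt_hermiteNormalized_mul j k

theorem integral_phi_mul_id_mul_phi (j k : ℕ) : ∫ x, phi j x * (x * phi k x) = jacobi j k := by
  have h (x : ℝ) : phi j x * (x * phi k x) =
      Real.sqrt (((k : ℝ) + 1) / 2) * (phi j x * phi (k + 1) x) +
        Real.sqrt ((k : ℝ) / 2) * (phi j x * phi (k - 1) x) := by
    rw [mul_phi]; ring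
  simp only [h]
  rw [integral_add ((integrable_phi_mul_phi _ _).const_mul _)
    ((integrable_phi_mul_phi _ _).const_mul _), integral_const_mul, integral_const_mul,
    integral_phi_mul_phi, integral_phi_mul_phi, jacobi]
  congr 1
  · simp
  · cases k <;> simp

/-- Fubini, then `z = S y` in each variable. The Jacobian cancels the normalisation `√S · √S`, and
the factor `x l` contributes the remaining `S⁻¹`. -/
theorem coordMatrix_apply {N : ℕ} {S : ℝ} (hS : 0 < S) (I : Finset (Fin N → ℕ)) (l : Fin N)
    (j k : I) : coordMatrix S I l j k =
      ∏ i, if i = l then S⁻¹ * jacobi (j.1 i) (k.1 i) else if j.1 i = k.1 i then 1 else 0 := by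
  have h (x : Fin N → ℝ) : phiN S j.1 x * (x l * phiN S k.1 x) =
      ∏ i, (fun y : ℝ => (fun z => S * (phi (j.1 i) z *
        ((if i = l then S⁻¹ * z else 1) * phi (k.1 i) z))) (S * y)) (x i) := by
    have hxl : x l = ∏ i, if i = l then S⁻¹ * (S * x i) else 1 := by
      rw [Finset.prod_ite_eq' Finset.univ l fun i => S⁻¹ * (S * x i)]
      simp [hS.ne']
    rw [phiN, phiN, hxl, ← Finset.prod_mul_distrib, ← Finset.prod_mul_distrib]
    refine Finset.prod_congr rfl fun i _ => ?_
    have := Real.mul_self_sqrt hS.le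
    simp only
    linear_combination (phi (j.1 i) (S * x i) *
        ((if i = l then S⁻¹ * (S * x i) else 1) * phi (k.1 i) (S * x i))) * this
  rw [coordMatrix]
  simp only [h]
  rw [integral_fintype_prod_volume_eq_prod (fun i (y : ℝ) => (fun z => S * (phi (j.1 i) z *
        ((if i = l then S⁻¹ * z else 1) * phi (k.1 i) z))) (S * y))]
  refine Finset.prod_congr rfl fun i _ => ?_
  rw [Measure.integral_comp_mul_left (fun z => S * (phi (j.1 i) z *
        ((if i = l then S⁻¹ * z else 1) * phi (k.1 i) z))) S, integral_const_mul,
    abs_of_pos (inv_pos.mpr hS), smul_eq_mul, inv_mul_cancel_left₀ hS.ne']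
  split_ifs with h1 h2
  · rw [← integral_phi_mul_id_mul_phi, ← integral_const_mul]
    congr 1
    ext z
    ring
  · simpa [h2] using integral_phi_mul_phi (k.1 i) (k.1 i)
  · simpa [h2] using integral_phi_mul_phi (j.1 i) (k.1 i)

/-! ### Spectral bounds for symmetric matrices -/

/-- Gershgorin: an eigenvalue is within the off-diagonal row sum of some diagonal entry, and adding
that entry's modulus gives the full row sum. -/
theorem abs_eigenvalues_le {ι : Type*} [Fintype ι] [DecidableEq ι] {A : Matrix ι ι ℝ}
    (hA : A.IsHermitian) {c : ℝ} (hc : ∀ i, ∑ j, |A i j| ≤ c) (i : ι) :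
    |hA.eigenvalues i| ≤ c := by
  have hev : Module.End.HasEigenvalue (Matrix.toLin' A) (hA.eigenvalues i) := by
    refine Module.End.hasEigenvalue_of_hasEigenvector (x := ⇑(hA.eigenvectorBasis i)) ?_
    rw [Module.End.hasEigenvector_iff, Module.End.mem_eigenspace_iff, Matrix.toLin'_apply]
    refine ⟨hA.mulVec_eigenvectorBasis i, fun h => ?_⟩
    have h1 := hA.eigenvectorBasis.orthonormal.1 i
    have h0 : hA.eigenvectorBasis i = 0 := by
      ext a
      exact congrFun h a
    simp [h0] at h1
  obtain ⟨k, hk⟩ := eigenvalue_mem_ball hev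
  refine le_trans ?_ (hc k)
  rw [mem_closedBall_iff_norm, Real.norm_eq_abs] at hk
  rw [← Finset.add_sum_erase _ _ (Finset.mem_univ k)]
  have := abs_add_le (hA.eigenvalues i - A k k) (A k k)
  rw [sub_add_cancel] at this
  simp only [Real.norm_eq_abs] at hk
  linarith

section OperatorNorm

open scoped Matrix.Norms.L2Operator

/-- A polynomial commutes with the orthogonal diagonalisation, and orthogonal factors leave the
operator norm unchanged. -/
theorem l2_opNorm_aeval_le {ι : Type*} [Fintype ι] [DecidableEq ι] {A : Matrix ι ι ℝ}
    (hA : A.IsHermitian) {q : ℝ[X]} {c : ℝ} (hc : 0 ≤ c)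
    (hq : ∀ i, |q.eval (hA.eigenvalues i)| ≤ c) : ‖aeval A q‖ ≤ c := by
  have h1 : aeval A q = Unitary.conjStarAlgAut ℝ _ hA.eigenvectorUnitary
      (Matrix.diagonal fun i => q.eval (hA.eigenvalues i)) := by
    conv_lhs => rw [hA.spectral_theorem]
    have h2 := aeval_algHom_apply
      (Unitary.conjStarAlgAut ℝ (Matrix ι ι ℝ) hA.eigenvectorUnitary).toAlgEquiv
      (Matrix.diagonal (RCLike.ofReal ∘ hA.eigenvalues)) q
    refine h2.trans ?_
    have h3 := aeval_algHom_apply (Matrix.diagonalAlgHom (n := ι) (α := ℝ) ℝ) hA.eigenvalues q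
    rw [aeval_pi_apply] at h3
    exact congrArg _ h3
  rw [h1, Unitary.conjStarAlgAut_apply]
  rw [CStarRing.norm_mul_mem_unitary _ (Unitary.star_mem hA.eigenvectorUnitary.2),
    CStarRing.norm_coe_unitary_mul, Matrix.l2_opNorm_diagonal]
  exact (pi_norm_le_iff_of_nonneg hc).mpr hq

theorem abs_apply_le_l2_opNorm {ι : Type*} [Fintype ι] [DecidableEq ι] (A : Matrix ι ι ℝ)
    (i j : ι) : |A i j| ≤ ‖A‖ := by
  have h := A.l2_opNorm_mulVec (EuclideanSpace.single j 1)
  rw [PiLp.norm_single, norm_one, mul_one] at h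
  have h2 := (PiLp.norm_apply_le _ i).trans h
  simpa using h2

theorem abs_list_prod_apply_le_one {ι κ : Type*} [Fintype ι] [DecidableEq ι]
    {A : κ → Matrix ι ι ℝ} (hA : ∀ l, ‖A l‖ ≤ 1) (s : List κ) (i j : ι) :
    |(s.map A).prod i j| ≤ 1 := by
  refine (abs_apply_le_l2_opNorm _ i j).trans ?_
  induction s with
  | nil =>
    have : Nonempty ι := ⟨i⟩
    simp
  | cons l s ih =>
    rw [List.map_cons, List.prod_cons]
    exact (norm_mul_le _ _).trans (mul_le_one₀ (hA l) (norm_nonneg _) ih)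

end OperatorNorm

variable {N : ℕ}

/-! ### Band structure -/

/-- All nonzero entries `M j k` satisfy `|j_l - k_l| ≤ b_l` for all `l`. -/
def Banded {I : Finset (Fin N → ℕ)} (b : Fin N → ℕ) (M : Matrix I I ℝ) : Prop :=
  ∀ j k, M j k ≠ 0 → j.1 ≤ k.1 + b ∧ k.1 ≤ j.1 + b

namespace Banded

variable {I : Finset (Fin N → ℕ)} {b c : Fin N → ℕ} {M M' : Matrix I I ℝ}

theorem mono (hM : Banded b M) (h : b ≤ c) : Banded c M := fun j k hjk =>
  ⟨(hM j k hjk).1.trans (add_le_add_right h _), (hM j k hjk).2.trans (add_le_add_right h _)⟩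

theorem one : Banded (I := I) b 1 := by
  intro j k hjk
  have h : j = k := by
    by_contra h
    exact hjk (Matrix.one_apply_ne h)
  subst h
  exact ⟨le_self_add, le_self_add⟩

theorem mul (hM : Banded b M) (hM' : Banded c M') : Banded (b + c) (M * M') := by
  intro j k hjk
  obtain ⟨i, -, hi⟩ := Finset.exists_ne_zero_of_sum_ne_zero hjk
  have h1 := hM j i (left_ne_zero_of_mul hi)
  have h2 := hM' i k (right_ne_zero_of_mul hi)
  constructor
  · calc j.1 ≤ i.1 + b := h1.1
      _ ≤ k.1 + c + b := add_le_add_left h2.1 b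
      _ = k.1 + (b + c) := by rw [add_assoc, add_comm c]
  · calc k.1 ≤ i.1 + c := h2.2
      _ ≤ j.1 + b + c := add_le_add_left h1.2 c
      _ = j.1 + (b + c) := by rw [add_assoc]

theorem smul (hM : Banded b M) (a : ℝ) : Banded b (a • M) := fun j k hjk =>
  hM j k (right_ne_zero_of_mul hjk)

theorem sum {ι : Type*} {s : Finset ι} {F : ι → Matrix I I ℝ} (hF : ∀ i ∈ s, Banded b (F i)) :
    Banded b (∑ i ∈ s, F i) := by
  intro j k hjk
  rw [Matrix.sum_apply] at hjk
  obtain ⟨i, hi, h⟩ := Finset.exists_ne_zero_of_sum_ne_zero hjk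
  exact hF i hi j k h

theorem pow (hM : Banded b M) (n : ℕ) : Banded (n • b) (M ^ n) := by
  induction n with
  | zero => rw [pow_zero]; exact one
  | succ n ih => rw [pow_succ', succ_nsmul']; exact hM.mul ih

theorem aeval (hM : Banded b M) {p : ℝ[X]} {d : ℕ} (hp : p.natDegree ≤ d) :
    Banded (d • b) (Polynomial.aeval M p) := by
  rw [aeval_eq_sum_range]
  refine sum fun i hi => ((hM.pow i).mono ?_).smul _
  exact nsmul_le_nsmul_left zero_le (by have := Finset.mem_range.mp hi; omega)

theorem list_prod {κ : Type*} {A : κ → Matrix I I ℝ} {B : κ → Fin N → ℕ}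
    (hA : ∀ l, Banded (B l) (A l)) (s : List κ) : Banded (s.map B).sum (s.map A).prod := by
  induction s with
  | nil => exact one
  | cons l s ih =>
    rw [List.map_cons, List.map_cons, List.sum_cons, List.prod_cons]
    exact (hA l).mul ih

end Banded

/-! ### Coordinate matrices over finite index sets -/

theorem coordMatrix_eq_ite {S : ℝ} (hS : 0 < S) (I : Finset (Fin N → ℕ)) (l : Fin N)
    (j k : I) : coordMatrix S I l j k =
      if j.1 = Function.update k.1 l (j.1 l) then S⁻¹ * jacobi (j.1 l) (k.1 l) else 0 := by
  rw [coordMatrix_apply hS]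
  split_ifs with h
  · rw [Finset.prod_eq_single l, if_pos rfl]
    · intro i _ hi
      rw [if_neg hi, if_pos]
      rw [h, Function.update_of_ne hi]
    · simp
  · obtain ⟨i, hi⟩ := Function.ne_iff.mp h
    have hil : i ≠ l := by
      rintro rfl
      simp at hi
    refine Finset.prod_eq_zero (Finset.mem_univ i) ?_
    rw [Function.update_of_ne hil] at hi
    rw [if_neg hil, if_neg hi]

theorem isHermitian_coordMatrix {S : ℝ} (hS : 0 < S) (I : Finset (Fin N → ℕ)) (l : Fin N) :
    (coordMatrix S I l).IsHermitian := by
  ext j k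
  rw [Matrix.conjTranspose_apply, coordMatrix_apply hS, coordMatrix_apply hS, star_trivial]
  refine Finset.prod_congr rfl fun i _ => ?_
  rw [jacobi_comm]
  simp only [eq_comm]

theorem coordMatrix_nonneg {S : ℝ} (hS : 0 < S) (I : Finset (Fin N → ℕ)) (l : Fin N)
    (j k : I) : 0 ≤ coordMatrix S I l j k := by
  rw [coordMatrix_eq_ite hS]
  have := jacobi_nonneg (j.1 l) (k.1 l)
  split_ifs <;> positivity

theorem banded_coordMatrix {S : ℝ} (hS : 0 < S) (I : Finset (Fin N → ℕ)) (l : Fin N) :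
    Banded (Pi.single l 1) (coordMatrix S I l) := by
  have h (j k : I) (hjk : coordMatrix S I l j k ≠ 0) : j.1 ≤ k.1 + Pi.single l 1 := by
    rw [coordMatrix_eq_ite hS] at hjk
    have h1 : j.1 = Function.update k.1 l (j.1 l) := by
      by_contra h
      exact hjk (if_neg h)
    rw [if_pos h1] at hjk
    have h2 := le_of_jacobi_ne_zero (right_ne_zero_of_mul hjk)
    intro i
    by_cases hi : i = l
    · subst hi
      simpa using h2
    · rw [h1, Function.update_of_ne hi]
      exact Nat.le_add_right _ _
  intro j k hjk
  refine ⟨h j k hjk, h k j ?_⟩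
  rwa [← (isHermitian_coordMatrix hS I l).apply, star_trivial] at hjk

/-- Only indices differing from `q` in coordinate `l` alone contribute. The cutoff at `q l + 1`
loses nothing because `jacobi` vanishes beyond it. -/
theorem sum_coordMatrix_mul {S : ℝ} (hS : 0 < S) (I : Finset (Fin N → ℕ)) (l : Fin N)
    (q : I) (f : (Fin N → ℕ) → ℝ) : ∑ j : I, f j.1 * coordMatrix S I l j q =
      S⁻¹ * ∑ a ∈ (Finset.range (q.1 l + 2)).filter fun a => Function.update q.1 l a ∈ I,
        jacobi a (q.1 l) * f (Function.update q.1 l a) := by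
  set t := (Finset.range (q.1 l + 2)).filter fun a => Function.update q.1 l a ∈ I
  have h1 : ∑ j : I, f j.1 * coordMatrix S I l j q =
      ∑ j ∈ I, if j = Function.update q.1 l (j l) then
        f j * (S⁻¹ * jacobi (j l) (q.1 l)) else 0 := by
    rw [← Finset.sum_coe_sort I]
    refine Finset.sum_congr rfl fun j _ => ?_
    rw [coordMatrix_eq_ite hS, mul_ite, mul_zero]
  have h2 : t.image (Function.update q.1 l) ⊆ I := by
    intro j hj
    obtain ⟨a, ha, rfl⟩ := Finset.mem_image.mp hj
    exact (Finset.mem_filter.mp ha).2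
  rw [h1, ← Finset.sum_subset h2, Finset.sum_image (Function.update_injective q.1 l).injOn,
    Finset.mul_sum]
  · refine Finset.sum_congr rfl fun a _ => ?_
    rw [Function.update_self, if_pos rfl]
    ring
  · intro j hj hjt
    split_ifs with h
    · have h3 : jacobi (j l) (q.1 l) = 0 := by
        by_contra h3
        refine hjt (Finset.mem_image.mpr ⟨j l, Finset.mem_filter.mpr ⟨?_, h ▸ hj⟩, h.symm⟩)
        have := le_of_jacobi_ne_zero h3
        exact Finset.mem_range.mpr (by omega)
      rw [h3, mul_zero, mul_zero]
    · rfl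

theorem sum_abs_coordMatrix_le {S : ℝ} (hS : 0 < S) {K : ℕ} {I : Finset (Fin N → ℕ)}
    (hI : I ⊆ fullSet N K) (l : Fin N) (q : I) :
    ∑ j, |coordMatrix S I l q j| ≤ S⁻¹ * Real.sqrt (2 * ((K : ℝ) + 1)) := by
  have h := sum_coordMatrix_mul hS I l q fun _ => 1
  simp only [one_mul, mul_one] at h
  have hq : q.1 l ≤ K :=
    Nat.lt_succ_iff.mp (Finset.mem_range.mp (Fintype.mem_piFinset.mp (hI q.2) l))
  calc ∑ j, |coordMatrix S I l q j| = ∑ j, coordMatrix S I l j q := by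
        refine Finset.sum_congr rfl fun j _ => ?_
        rw [abs_of_nonneg (coordMatrix_nonneg hS I l q j),
          ← (isHermitian_coordMatrix hS I l).apply, star_trivial]
    _ ≤ _ := by
        rw [h]
        exact mul_le_mul_of_nonneg_left (sum_jacobi_le hq) (inv_nonneg.mpr hS.le)

/-! ### Insertion of coordinate matrices and point evaluation -/

/-- The three-term recurrence in variable `l`. The lower neighbour is in `I` because `I` is a lower
set; the upper one is either present or contributes zero at `ξ`. -/
theorem sum_prod_phi_mul_coordMatrix {S : ℝ} (hS : 0 < S) {I : Finset (Fin N → ℕ)}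
    (hI : IsLowerSet (I : Set (Fin N → ℕ))) (l : Fin N) (q : I) (ξ : Fin N → ℝ)
    (h : Function.update q.1 l (q.1 l + 1) ∈ I ∨ phi (q.1 l + 1) (ξ l) = 0) :
    ∑ j : I, (∏ i, phi (j.1 i) (ξ i)) * coordMatrix S I l j q =
      (ξ l / S) * ∏ i, phi (q.1 i) (ξ i) := by
  have hupd (a : ℕ) : ∏ i, phi (Function.update q.1 l a i) (ξ i) =
      phi a (ξ l) * ∏ i ∈ Finset.univ.erase l, phi (q.1 i) (ξ i) := by
    rw [← Finset.mul_prod_erase _ _ (Finset.mem_univ l), Function.update_self]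
    congr 1
    refine Finset.prod_congr rfl fun i hi => ?_
    rw [Function.update_of_ne (Finset.ne_of_mem_erase hi)]
  have hself := hupd (q.1 l)
  rw [Function.update_eq_self] at hself
  rw [sum_coordMatrix_mul hS I l q fun j => ∏ i, phi (j i) (ξ i), sum_jacobi_mul, hself]
  simp only [hupd]
  have hpred : q.1 l - 1 ∈ (Finset.range (q.1 l + 2)).filter
      fun a => Function.update q.1 l a ∈ I := by
    refine Finset.mem_filter.mpr ⟨Finset.mem_range.mpr (by omega), hI ?_ q.2⟩
    exact update_le_self_iff.mpr (Nat.sub_le _ _)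
  rw [if_pos hpred]
  have hsucc : (if q.1 l + 1 ∈ (Finset.range (q.1 l + 2)).filter
      (fun a => Function.update q.1 l a ∈ I) then phi (q.1 l + 1) (ξ l) *
        ∏ i ∈ Finset.univ.erase l, phi (q.1 i) (ξ i) else 0) = phi (q.1 l + 1) (ξ l) *
        ∏ i ∈ Finset.univ.erase l, phi (q.1 i) (ξ i) := by
    split_ifs with h1
    · rfl
    · rw [h.resolve_left fun h2 => h1 (Finset.mem_filter.mpr
        ⟨Finset.mem_range.mpr (by omega), h2⟩), zero_mul]
  rw [hsucc]
  linear_combination (-S⁻¹ * ∏ i ∈ Finset.univ.erase l, phi (q.1 i) (ξ i)) * mul_phi (q.1 l) (ξ l)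

/-- If `y` is a right eigenvalue of `X` along all columns reached from `k` by `M` and at most
`d` further steps, then `p(X)` acts as `p(y)`. -/
theorem vecMul_aeval_mul {I : Finset (Fin N → ℕ)} {X M : Matrix I I ℝ} {b e B : Fin N → ℕ}
    (hX : Banded e X) (hM : Banded b M) {Φ : I → ℝ} {y : ℝ} {p : ℝ[X]} {d : ℕ}
    (hp : p.natDegree ≤ d)
    (hΦ : ∀ q : I, q.1 + e ≤ B → Matrix.vecMul Φ X q = y * Φ q) (k : I)
    (hk : k.1 + b + d • e ≤ B) :
    Matrix.vecMul Φ (aeval X p * M) k = p.eval y * Matrix.vecMul Φ M k := by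
  have hpow : ∀ i ≤ d, Matrix.vecMul Φ (X ^ i * M) k = y ^ i * Matrix.vecMul Φ M k := by
    intro i
    induction i with
    | zero => simp
    | succ i ih =>
      intro hi
      rw [pow_succ', pow_succ', mul_assoc, mul_assoc, ← ih (by omega), ← Matrix.vecMul_vecMul]
      simp only [Matrix.vecMul, dotProduct, Finset.mul_sum]
      refine Finset.sum_congr rfl fun q _ => ?_
      -- Bandedness of `X ^ i * M` confines its nonzero entries in column `k` to indices `q` where
      -- one more step stays below `B`, so the eigenvalue relation is available there.
      by_cases h0 : (X ^ i * M) q k = 0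
      · rw [h0]; ring
      · have h1 := (((hX.pow i).mul hM) q k h0).1
        have h2 : q.1 + e ≤ B := by
          refine le_trans ?_ hk
          calc q.1 + e ≤ k.1 + (i • e + b) + e := add_le_add_left h1 e
            _ = k.1 + b + (i + 1) • e := by rw [succ_nsmul]; abel
            _ ≤ k.1 + b + d • e :=
              add_le_add_right (nsmul_le_nsmul_left zero_le hi) _
        have h3 := hΦ q h2
        rw [Matrix.vecMul, dotProduct] at h3
        rw [h3]
        ring
  rw [aeval_eq_sum_range, Finset.sum_mul, Matrix.vecMul_sum, Finset.sum_apply,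
    eval_eq_sum_range, Finset.sum_mul]
  refine Finset.sum_congr rfl fun i hi => ?_
  rw [smul_mul_assoc, Matrix.vecMul_smul, Pi.smul_apply, smul_eq_mul,
    hpow i (by have := Finset.mem_range.mp hi; omega), mul_assoc]

/-- The leftmost factor is peeled off by `vecMul_aeval_mul`, with the rest of the product as `M` and
its accumulated bandwidth as `b`. The matrices need not commute. -/
theorem vecMul_list_prod {κ : Type*} {I : Finset (Fin N → ℕ)} {X : κ → Matrix I I ℝ}
    {e : κ → Fin N → ℕ} {B : Fin N → ℕ} (hX : ∀ l, Banded (e l) (X l)) {Φ : I → ℝ} {y : κ → ℝ}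
    {p : κ → ℝ[X]} {d : κ → ℕ} (hp : ∀ l, (p l).natDegree ≤ d l)
    (hΦ : ∀ l, ∀ q : I, q.1 + e l ≤ B → Matrix.vecMul Φ (X l) q = y l * Φ q) (k : I)
    (s : List κ) (hk : k.1 + (s.map fun l => d l • e l).sum ≤ B) :
    Matrix.vecMul Φ (s.map fun l => aeval (X l) (p l)).prod k =
      (s.map fun l => (p l).eval (y l)).prod * Φ k := by
  induction s with
  | nil => simp
  | cons l s ih =>
    rw [List.map_cons, List.sum_cons] at hk
    rw [List.map_cons, List.prod_cons, List.map_cons, List.prod_cons,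
      vecMul_aeval_mul (hX l)
        (Banded.list_prod (fun l => (hX l).aeval (hp l)) s) (hp l) (hΦ l) k
        (by rwa [add_assoc, add_comm (List.sum _)]),
      ih (le_trans (add_le_add_right (le_add_of_nonneg_left zero_le) _) hk), mul_assoc]

/-! ### Chebyshev products: insertion and quadrature -/

/-- Insertion of the coordinate matrices over `I` into `∏ l, T_{r_l}(x_l / L)`. -/
def chebyshevInsert (L S : ℝ) (I : Finset (Fin N → ℕ)) (r : Fin N → ℕ) : Matrix I I ℝ :=
  (List.ofFn fun l : Fin N =>
    aeval (L⁻¹ • coordMatrix S I l) (Chebyshev.T ℝ (r l : ℤ))).prod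

/-- The Gauss-Hermite approximation of the Galerkin matrix entry of `∏ l, T_{r_l}(x_l / L)`. -/
def chebyshevQuadrature (L S : ℝ) (M : ℕ) (r j k : Fin N → ℕ) : ℝ :=
  ∑ ξ ∈ Fintype.piFinset fun _ : Fin N => ghNodes M,
    (∏ l, ghWeight M (ξ l) * Real.exp (ξ l ^ 2)) * (∏ l, phi (j l) (ξ l)) *
      (∏ l, (Chebyshev.T ℝ (r l : ℤ)).eval (ξ l / S / L)) * ∏ l, phi (k l) (ξ l)

theorem WpolInsert_eq (𝓡 : Finset (Fin N → ℕ)) (α : (Fin N → ℕ) → ℝ) (L S : ℝ)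
    (I : Finset (Fin N → ℕ)) :
    WpolInsert 𝓡 α L S I = ∑ r ∈ 𝓡, α r • chebyshevInsert L S I r := rfl

theorem ghMatrix_apply (𝓡 : Finset (Fin N → ℕ)) (α : (Fin N → ℕ) → ℝ) (L S : ℝ) (M : ℕ)
    (I : Finset (Fin N → ℕ)) (j k : I) :
    ghMatrix 𝓡 α L S M I j k = ∑ r ∈ 𝓡, α r * chebyshevQuadrature L S M r j.1 k.1 := by
  simp only [ghMatrix, Wpol, chebyshevQuadrature, Finset.mul_sum, Finset.sum_mul]
  rw [Finset.sum_comm]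
  refine Finset.sum_congr rfl fun r _ => Finset.sum_congr rfl fun ξ _ => ?_
  ring

theorem isLowerSet_fullSet (N K : ℕ) : IsLowerSet (fullSet N K : Set (Fin N → ℕ)) := by
  intro q p hpq hq
  refine Fintype.mem_piFinset.mpr fun l => Finset.mem_range.mpr ?_
  have := Finset.mem_range.mp (Fintype.mem_piFinset.mp hq l)
  exact (hpq l).trans_lt this

theorem prod_one_add_le {p q : Fin N → ℕ} (h : p ≤ q) : ∏ l, (1 + p l) ≤ ∏ l, (1 + q l) :=
  Finset.prod_le_prod' fun l _ => Nat.add_le_add_left (h l) 1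

theorem isLowerSet_hypSet (N K : ℕ) : IsLowerSet (hypSet N K : Set (Fin N → ℕ)) :=
  fun _ _ hpq hq => mem_hypSet.mpr ((prod_one_add_le hpq).trans (mem_hypSet.mp hq))

theorem hypSet_subset_fullSet (N K : ℕ) : hypSet N K ⊆ fullSet N K := Finset.filter_subset _ _

theorem mem_fullSet {K : ℕ} {k : Fin N → ℕ} : k ∈ fullSet N K ↔ ∀ l, k l ≤ K := by
  simp [fullSet]

theorem natDegree_chebyshevT (n : ℕ) : (Chebyshev.T ℝ (n : ℤ)).natDegree ≤ n := by
  rw [Chebyshev.natDegree_T, Int.natAbs_natCast]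

theorem sum_map_finRange_single (r : Fin N → ℕ) :
    ((List.finRange N).map fun l => r l • (Pi.single l 1 : Fin N → ℕ)).sum = r := by
  rw [← List.ofFn_eq_map, List.sum_ofFn]
  simp_rw [← Pi.single_smul, smul_eq_mul, mul_one]
  exact Finset.univ_sum_single r

theorem banded_chebyshevInsert {S : ℝ} (hS : 0 < S) (L : ℝ) (I : Finset (Fin N → ℕ))
    (r : Fin N → ℕ) : Banded r (chebyshevInsert L S I r) := by
  have h := Banded.list_prod (fun l => ((banded_coordMatrix hS I l).smul L⁻¹).aeval
    (natDegree_chebyshevT (r l))) (List.finRange N)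
  rw [sum_map_finRange_single] at h
  rwa [chebyshevInsert, List.ofFn_eq_map]

theorem abs_chebyshevInsert_le {K : ℕ} {L S : ℝ} (hL : 0 < L) (hS : 0 < S)
    (hSL : Real.sqrt (2 * ((K : ℝ) + 1)) ≤ S * L) {I : Finset (Fin N → ℕ)}
    (hI : I ⊆ fullSet N K) (r : Fin N → ℕ) (j k : I) : |chebyshevInsert L S I r j k| ≤ 1 := by
  rw [chebyshevInsert, List.ofFn_eq_map]
  refine abs_list_prod_apply_le_one (fun l => ?_) _ j k
  have hA : (L⁻¹ • coordMatrix S I l).IsHermitian := by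
    ext a b
    simp only [Matrix.conjTranspose_apply, Matrix.smul_apply, star_trivial]
    rw [← (isHermitian_coordMatrix hS I l).apply, star_trivial]
  refine l2_opNorm_aeval_le hA zero_le_one fun i => ?_
  refine Chebyshev.abs_eval_T_real_le_one _ (abs_eigenvalues_le hA (fun a => ?_) i)
  simp only [Matrix.smul_apply, smul_eq_mul, abs_mul, abs_of_pos (inv_pos.mpr hL)]
  rw [← Finset.mul_sum]
  calc L⁻¹ * ∑ b, |coordMatrix S I l a b| ≤ L⁻¹ * (S⁻¹ * (S * L)) := by
        refine mul_le_mul_of_nonneg_left ?_ (inv_nonneg.mpr hL.le)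
        exact (sum_abs_coordMatrix_le hS hI l a).trans
          (mul_le_mul_of_nonneg_left hSL (inv_nonneg.mpr hS.le))
    _ = 1 := by field_simp

theorem sum_prod_ghWeight_mul_phi {M : ℕ} {j k : Fin N → ℕ} (hj : j ∈ fullSet N M)
    (hk : k ∈ fullSet N M) :
    ∑ ξ ∈ Fintype.piFinset fun _ : Fin N => ghNodes M,
      (∏ l, ghWeight M (ξ l) * Real.exp (ξ l ^ 2)) * (∏ l, phi (j l) (ξ l)) *
        ∏ l, phi (k l) (ξ l) = if j = k then 1 else 0 := by
  simp only [← Finset.prod_mul_distrib]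
  rw [Finset.sum_prod_piFinset (ghNodes M)
    (fun l x => ghWeight M x * Real.exp (x ^ 2) * phi (j l) x * phi (k l) x)]
  simp only [mul_assoc (_ * _) (phi _ _) (phi _ _)]
  simp only [sum_ghWeight_mul_phi_mul_phi (mem_fullSet.mp hj _) (mem_fullSet.mp hk _)]
  split_ifs with h
  · simp [h]
  · obtain ⟨l, hl⟩ := Function.ne_iff.mp h
    exact Finset.prod_eq_zero (Finset.mem_univ l) (if_neg hl)

/-- Quadrature and insertion over `I` agree in the column `k` if stepping out of `I` inside the
box `[0, k + r]` only meets functions that vanish at all nodes. -/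
theorem chebyshevQuadrature_eq {M : ℕ} {S : ℝ} (hS : 0 < S) (L : ℝ) {I : Finset (Fin N → ℕ)}
    (hI : I ⊆ fullSet N M) (hlow : IsLowerSet (I : Set (Fin N → ℕ))) (r : Fin N → ℕ) (j k : I)
    (hstep : ∀ q ∈ I, ∀ l, Function.update q l (q l + 1) ≤ k.1 + r →
      Function.update q l (q l + 1) ∈ I ∨ q l = M) :
    chebyshevQuadrature L S M r j.1 k.1 = chebyshevInsert L S I r j k := by
  have hcol (ξ : Fin N → ℝ) (hξ : ξ ∈ Fintype.piFinset fun _ : Fin N => ghNodes M) :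
      (∏ l, (Chebyshev.T ℝ (r l : ℤ)).eval (ξ l / S / L)) * ∏ l, phi (k.1 l) (ξ l) =
        ∑ i : I, (∏ l, phi (i.1 l) (ξ l)) * chebyshevInsert L S I r i k := by
    have h := vecMul_list_prod (X := fun l => L⁻¹ • coordMatrix S I l)
      (e := fun l => Pi.single l 1) (B := k.1 + r)
      (fun l => (banded_coordMatrix hS I l).smul L⁻¹) (Φ := fun i => ∏ l, phi (i.1 l) (ξ l))
      (y := fun l => ξ l / S / L) (p := fun l => Chebyshev.T ℝ (r l : ℤ)) (d := r)
      (fun l => natDegree_chebyshevT (r l)) (fun l q hq => ?_) k (List.finRange N)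
      (by rw [sum_map_finRange_single])
    · rw [← List.ofFn_eq_map, ← List.ofFn_eq_map, List.prod_ofFn] at h
      exact h.symm
    · have hupd : Function.update q.1 l (q.1 l + 1) = q.1 + Pi.single l 1 := by
        ext i
        by_cases hi : i = l
        · subst hi; simp
        · simp [hi]
      rw [Matrix.vecMul_smul, Pi.smul_apply, smul_eq_mul]
      -- If `q l = M`, the missing neighbour carries the factor `φ_{M+1}`, which vanishes at the
      -- nodes.
      have h1 := sum_prod_phi_mul_coordMatrix hS hlow l q ξ
        ((hstep q.1 q.2 l (hupd ▸ hq)).imp id fun hq => by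
          have h2 := mem_ghNodes.mp (Fintype.mem_piFinset.mp hξ l)
          rw [phi_eq, hq, h2, zero_mul])
      rw [Matrix.vecMul, dotProduct, h1]
      ring
  rw [chebyshevQuadrature]
  calc _ = ∑ ξ ∈ Fintype.piFinset fun _ : Fin N => ghNodes M, ∑ i : I,
        (∏ l, ghWeight M (ξ l) * Real.exp (ξ l ^ 2)) * (∏ l, phi (j.1 l) (ξ l)) *
          (∏ l, phi (i.1 l) (ξ l)) * chebyshevInsert L S I r i k := by
        refine Finset.sum_congr rfl fun ξ hξ => ?_
        rw [mul_assoc, hcol ξ hξ, Finset.mul_sum]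
        exact Finset.sum_congr rfl fun i _ => (mul_assoc _ _ _).symm
    -- Discrete orthonormality: `φ_j φ_i` has polynomial degree at most `2M` in each variable, so
    -- Gauss-Hermite quadrature is exact for it.
    _ = ∑ i : I, (if j.1 = i.1 then 1 else 0) * chebyshevInsert L S I r i k := by
        rw [Finset.sum_comm]
        refine Finset.sum_congr rfl fun i _ => ?_
        rw [← Finset.sum_mul, sum_prod_ghWeight_mul_phi (hI j.2) (hI i.2)]
    _ = chebyshevInsert L S I r j k := by
        simp only [SetLike.coe_eq_coe, ite_mul, one_mul, zero_mul]
        rw [Finset.sum_ite_eq, if_pos (Finset.mem_univ j)]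

/-- A step can leave the box only by raising a coordinate equal to `M`, so there is no condition on
`k` or `r`. This transfers band and norm bounds from insertions to the quadrature. -/
theorem chebyshevQuadrature_eq_fullSet {M : ℕ} {S : ℝ} (hS : 0 < S) (L : ℝ) (r : Fin N → ℕ)
    (j k : fullSet N M) :
    chebyshevQuadrature L S M r j.1 k.1 = chebyshevInsert L S (fullSet N M) r j k := by
  refine chebyshevQuadrature_eq hS L subset_rfl (isLowerSet_fullSet N M) r j k ?_
  intro q hq l _
  rw [or_iff_not_imp_right]
  intro hne
  refine mem_fullSet.mpr fun i => ?_
  have hqi := mem_fullSet.mp hq i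
  by_cases hi : i = l
  · subst hi
    rw [Function.update_self]
    omega
  · rwa [Function.update_of_ne hi]

theorem chebyshevQuadrature_eq_hypSet {K : ℕ} {S : ℝ} (hS : 0 < S) (L : ℝ) (r : Fin N → ℕ)
    (j k : hypSet N K) (hk : ∏ l, (1 + (k.1 l + r l)) ≤ K + 1) :
    chebyshevQuadrature L S K r j.1 k.1 = chebyshevInsert L S (hypSet N K) r j k :=
  chebyshevQuadrature_eq hS L (hypSet_subset_fullSet N K) (isLowerSet_hypSet N K) r j k
    fun _ _ _ h => Or.inl (mem_hypSet.mpr ((prod_one_add_le h).trans hk))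

/-! ### The error due to index set reduction -/

theorem prod_max_zpow_neg_le {K β : ℕ} (hK : 1 ≤ K) {k r : Fin N → ℕ}
    (h : K + 1 < ∏ l, (1 + (k l + r l))) :
    ∏ l, ((max (k l) 1 : ℕ) : ℝ) ^ (-(β : ℤ)) ≤
      (K : ℝ) ^ (-(β : ℤ)) * ∏ l, ((r l : ℝ) + 2) ^ β := by
  -- Factorwise, `1 + k + r ≤ max k 1 * (r + 2)`, which separates `k` from `r`.
  have h1 : K ≤ ∏ l, (max (k l) 1 * (r l + 2)) := by
    refine le_trans (by omega) (Finset.prod_le_prod' (f := fun l => 1 + (k l + r l))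
      fun l _ => ?_)
    rcases Nat.eq_zero_or_pos (k l) with h0 | h0
    · rw [h0, max_eq_right zero_le_one]
      omega
    · rw [max_eq_left h0]
      nlinarith
  have h2 : (K : ℝ) ≤ (∏ l, ((max (k l) 1 : ℕ) : ℝ)) * ∏ l, ((r l : ℝ) + 2) := by
    rw [← Finset.prod_mul_distrib]
    exact_mod_cast h1
  have hKpos : (0 : ℝ) < K := by exact_mod_cast hK
  have hP : 0 < ∏ l, ((max (k l) 1 : ℕ) : ℝ) :=
    Finset.prod_pos fun l _ => by exact_mod_cast lt_max_of_lt_right one_pos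
  rw [Finset.prod_zpow, Finset.prod_pow, zpow_neg, zpow_neg, zpow_natCast, zpow_natCast,
    inv_le_iff_one_le_mul₀ (pow_pos hP β), mul_assoc, ← mul_pow, ← div_eq_inv_mul,
    one_le_div (pow_pos hKpos β), mul_comm (∏ l, ((r l : ℝ) + 2))]
  exact pow_le_pow_left₀ hKpos.le h2 β

/-- Both terms are entries of contractions: an insertion over the hyperbolic set and one over the
full box. -/
theorem abs_chebyshevInsert_sub_quadrature_le {K : ℕ} {L S : ℝ} (hL : 0 < L) (hS : 0 < S)
    (hSL : Real.sqrt (2 * ((K : ℝ) + 1)) ≤ S * L) (r : Fin N → ℕ) (j k : hypSet N K) :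
    |chebyshevInsert L S (hypSet N K) r j k - chebyshevQuadrature L S K r j.1 k.1| ≤ 2 := by
  have h1 := abs_chebyshevInsert_le hL hS hSL (hypSet_subset_fullSet N K) r j k
  have h2 := abs_chebyshevInsert_le hL hS hSL subset_rfl r
    ⟨j.1, hypSet_subset_fullSet N K j.2⟩ ⟨k.1, hypSet_subset_fullSet N K k.2⟩
  rw [← chebyshevQuadrature_eq_fullSet hS] at h2
  exact (abs_sub _ _).trans (by linarith)

theorem mem_box_of_chebyshevInsert_sub_quadrature_ne_zero {K : ℕ} {L S : ℝ} (hS : 0 < S)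
    {r : Fin N → ℕ} {j k : hypSet N K}
    (h : chebyshevInsert L S (hypSet N K) r j k - chebyshevQuadrature L S K r j.1 k.1 ≠ 0) :
    k.1 ∈ Fintype.piFinset fun l => Finset.Icc (j.1 l - r l) (j.1 l + r l) := by
  have h1 : j.1 ≤ k.1 + r ∧ k.1 ≤ j.1 + r := by
    by_cases h2 : chebyshevInsert L S (hypSet N K) r j k = 0
    · rw [h2, zero_sub, neg_ne_zero, chebyshevQuadrature_eq_fullSet hS L r
        ⟨j.1, hypSet_subset_fullSet N K j.2⟩ ⟨k.1, hypSet_subset_fullSet N K k.2⟩] at h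
      exact banded_chebyshevInsert hS L (fullSet N K) r _ _ h
    · exact banded_chebyshevInsert hS L _ r _ _ h2
  refine Fintype.mem_piFinset.mpr fun l => Finset.mem_Icc.mpr ⟨?_, h1.2 l⟩
  exact Nat.sub_le_iff_le_add.mpr (h1.1 l)

theorem card_box_le (r j : Fin N → ℕ) :
    (Fintype.piFinset fun l => Finset.Icc (j l - r l) (j l + r l)).card ≤
      ∏ l, (2 * (r l + 1)) := by
  rw [Fintype.card_piFinset]
  refine Finset.prod_le_prod' fun l _ => ?_
  rw [Nat.card_Icc]
  omega

theorem sum_abs_chebyshevInsert_sub_quadrature_mul_le {K β : ℕ} {L S A : ℝ} (hL : 0 < L)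
    (hS : 0 < S) (hK : 1 ≤ K) (hSL : Real.sqrt (2 * ((K : ℝ) + 1)) ≤ S * L) (hA : 0 ≤ A)
    (r : Fin N → ℕ) (j : hypSet N K) {v : hypSet N K → ℂ}
    (hv : ∀ k : hypSet N K, ‖v k‖ ≤ A * ∏ l, ((max (k.1 l) 1 : ℕ) : ℝ) ^ (-(β : ℤ))) :
    ∑ k, |chebyshevInsert L S (hypSet N K) r j k - chebyshevQuadrature L S K r j.1 k.1| * ‖v k‖ ≤
      (∏ l, (2 * ((r l : ℝ) + 1))) *
        (2 * (A * ((K : ℝ) ^ (-(β : ℤ)) * ∏ l, ((r l : ℝ) + 2) ^ β))) := by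
  set E : ℝ := 2 * (A * ((K : ℝ) ^ (-(β : ℤ)) * ∏ l, ((r l : ℝ) + 2) ^ β)) with hE
  have hE0 : 0 ≤ E := by positivity
  set box := Fintype.piFinset fun l => Finset.Icc (j.1 l - r l) (j.1 l + r l) with hbox
  have hterm (k : hypSet N K) :
      |chebyshevInsert L S (hypSet N K) r j k - chebyshevQuadrature L S K r j.1 k.1| * ‖v k‖ ≤
        if k.1 ∈ box then E else 0 := by
    by_cases h0 : chebyshevInsert L S (hypSet N K) r j k - chebyshevQuadrature L S K r j.1 k.1 = 0
    · rw [h0, abs_zero, zero_mul]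
      split_ifs <;> simp [hE0]
    · rw [if_pos (mem_box_of_chebyshevInsert_sub_quadrature_ne_zero hS h0)]
      have hk : K + 1 < ∏ l, (1 + (k.1 l + r l)) := by
        by_contra hk
        exact h0 (by rw [chebyshevQuadrature_eq_hypSet hS L r j k (not_lt.mp hk), sub_self])
      exact mul_le_mul (abs_chebyshevInsert_sub_quadrature_le hL hS hSL r j k)
        ((hv k).trans (mul_le_mul_of_nonneg_left (prod_max_zpow_neg_le hK hk) hA))
        (norm_nonneg _) zero_le_two
  refine (Finset.sum_le_sum fun k _ => hterm k).trans ?_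
  rw [Finset.sum_coe_sort (hypSet N K) fun k => if k ∈ box then E else 0, ← Finset.sum_filter,
    Finset.sum_const, nsmul_eq_mul]
  refine mul_le_mul_of_nonneg_right ?_ hE0
  have h1 : ((hypSet N K).filter fun k => k ∈ box).card ≤ ∏ l, (2 * (r l + 1)) :=
    (Finset.card_le_card fun k hk => (Finset.mem_filter.mp hk).2).trans (card_box_le r j.1)
  exact_mod_cast h1

theorem prod_mul_prod_le_redConst_factor (β : ℕ) (r : Fin N → ℕ) :
    (∏ l, (2 * ((r l : ℝ) + 1))) * (2 * ∏ l, ((r l : ℝ) + 2) ^ β) ≤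
      2 * 8 ^ N * ((2 : ℝ) ^ (((β : ℤ) - 2) * (N : ℤ)) *
        ∏ l, (((r l).choose (r l / 2 - 1) : ℝ) * Real.sqrt 2 ^ (r l) *
          ((r l : ℝ) + 1) ^ (β + 3))) := by
  -- Each direction costs `2 * 2 ^ β`: the 2 comes from the band count, and `2 ^ β` from `r + 2 ≤ 2
  -- (r + 1)`. Since `2 ^ (β - 2)` supplies only a quarter of `2 ^ β`, a factor 8 per direction is
  -- required.
  have hpow : (8 : ℝ) ^ N * (2 : ℝ) ^ (((β : ℤ) - 2) * (N : ℤ)) = ∏ _l : Fin N, (2 * 2 ^ β) := by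
    rw [Finset.prod_const, Finset.card_univ, Fintype.card_fin, zpow_mul, zpow_natCast, ← mul_pow,
      zpow_sub₀ two_ne_zero, zpow_natCast]
    congr 1
    norm_num
    ring
  calc (∏ l, (2 * ((r l : ℝ) + 1))) * (2 * ∏ l, ((r l : ℝ) + 2) ^ β)
      = 2 * ∏ l, (2 * ((r l : ℝ) + 1) * ((r l : ℝ) + 2) ^ β) := by
        rw [Finset.prod_mul_distrib (f := fun l => 2 * ((r l : ℝ) + 1))]
        ring
    _ ≤ 2 * ∏ l, (2 * 2 ^ β * (((r l).choose (r l / 2 - 1) : ℝ) * Real.sqrt 2 ^ (r l) *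
          ((r l : ℝ) + 1) ^ (β + 3))) := by
        refine mul_le_mul_of_nonneg_left (Finset.prod_le_prod (fun l _ => by positivity)
          fun l _ => ?_) zero_le_two
        have hr : (0 : ℝ) ≤ r l := Nat.cast_nonneg _
        have h1 : (1 : ℝ) ≤ (r l).choose (r l / 2 - 1) := by
          exact_mod_cast Nat.choose_pos (by omega)
        have h2 : (1 : ℝ) ≤ Real.sqrt 2 ^ (r l) :=
          one_le_pow₀ (Real.one_le_sqrt.mpr one_le_two)
        have h3 : ((r l : ℝ) + 2) ^ β ≤ 2 ^ β * ((r l : ℝ) + 1) ^ β := by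
          rw [← mul_pow]
          exact pow_le_pow_left₀ (by positivity) (by linarith) β
        have h4 : ((r l : ℝ) + 1) ^ (β + 1) ≤ ((r l : ℝ) + 1) ^ (β + 3) :=
          pow_le_pow_right₀ (by linarith) (by omega)
        calc 2 * ((r l : ℝ) + 1) * ((r l : ℝ) + 2) ^ β
            ≤ 2 * ((r l : ℝ) + 1) * (2 ^ β * ((r l : ℝ) + 1) ^ β) :=
              mul_le_mul_of_nonneg_left h3 (by positivity)
          _ = 2 * 2 ^ β * (1 * ((r l : ℝ) + 1) ^ (β + 1)) := by ring
          _ ≤ _ := mul_le_mul_of_nonneg_left (mul_le_mul (one_le_mul_of_one_le_of_one_le h1 h2) h4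
              (by positivity) (by positivity)) (by positivity)
    _ = _ := by
        rw [Finset.prod_mul_distrib (f := fun _ => 2 * 2 ^ β), ← hpow]
        ring

end HermiteGalerkin

end

theorem mainTheorem2 (N : ℕ) :
    ∃ c : ℝ, 0 < c ∧
      ∀ (β : ℕ) (𝓡 : Finset (Fin N → ℕ)) (α : (Fin N → ℕ) → ℝ → ℝ) (L t : ℝ), 0 < L →
      ∀ (K : ℕ) (S : ℝ), 1 ≤ K → 0 < S → Real.sqrt (2 * ((K : ℝ) + 1)) + 1 ≤ S * L →
      ∀ (v : HermiteGalerkin.hypSet N K → ℂ) (A : ℝ),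
        (∀ k : HermiteGalerkin.hypSet N K,
          ‖v k‖ ≤ A * ∏ l, ((max (k.1 l) 1 : ℕ) : ℝ) ^ (-(β : ℤ))) →
        ∀ j : HermiteGalerkin.hypSet N K,
          ‖(((HermiteGalerkin.WpolInsert 𝓡 (fun r => α r t) L S (HermiteGalerkin.hypSet N K) -
              HermiteGalerkin.ghMatrix 𝓡 (fun r => α r t) L S K (HermiteGalerkin.hypSet N K)).map
                (fun x : ℝ => (x : ℂ))).mulVec v) j‖ ≤
            A * (c * HermiteGalerkin.redConst β 𝓡 (fun r => α r t)) * (K : ℝ) ^ (-(β : ℤ)) := by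
  open HermiteGalerkin in
  -- The 2 is the bound on the entries of the difference; `8 ^ N` comes from
  -- `prod_mul_prod_le_redConst_factor`.
  refine ⟨2 * 8 ^ N, by positivity, ?_⟩
  intro β 𝓡 α L t hL K S hK hS hSL v A hv j
  -- The row index `j` is itself in the index set, so the decay bound at `j` forces `A ≥ 0`.
  have hA : 0 ≤ A := by
    have h := (norm_nonneg _).trans (hv j)
    refine nonneg_of_mul_nonneg_left h (Finset.prod_pos fun l _ => zpow_pos ?_ _)
    exact_mod_cast lt_max_of_lt_right one_pos
  have hSL' : Real.sqrt (2 * ((K : ℝ) + 1)) ≤ S * L := by linarith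
  set D : (Fin N → ℕ) → hypSet N K → ℝ := fun r k =>
    chebyshevInsert L S (hypSet N K) r j k - chebyshevQuadrature L S K r j.1 k.1 with hD
  have hentry (k : hypSet N K) :
      (WpolInsert 𝓡 (fun r => α r t) L S (hypSet N K) -
        ghMatrix 𝓡 (fun r => α r t) L S K (hypSet N K)) j k = ∑ r ∈ 𝓡, α r t * D r k := by
    rw [Matrix.sub_apply, WpolInsert_eq, ghMatrix_apply, Matrix.sum_apply,
      ← Finset.sum_sub_distrib]
    refine Finset.sum_congr rfl fun r _ => ?_
    rw [Matrix.smul_apply, smul_eq_mul, ← mul_sub]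
  have hK0 : 0 ≤ (K : ℝ) ^ (-(β : ℤ)) := by positivity
  rw [Matrix.mulVec, dotProduct]
  calc _ ≤ ∑ k, ∑ r ∈ 𝓡, |α r t| * (|D r k| * ‖v k‖) := by
        refine (norm_sum_le _ _).trans (Finset.sum_le_sum fun k _ => ?_)
        rw [Matrix.map_apply, hentry, norm_mul, Complex.norm_real, Real.norm_eq_abs]
        simp only [← mul_assoc, ← Finset.sum_mul, ← abs_mul]
        exact mul_le_mul_of_nonneg_right (Finset.abs_sum_le_sum_abs _ _) (norm_nonneg _)
    _ = ∑ r ∈ 𝓡, |α r t| * ∑ k, |D r k| * ‖v k‖ := by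
        rw [Finset.sum_comm]
        simp only [Finset.mul_sum]
    _ ≤ ∑ r ∈ 𝓡, A * (K : ℝ) ^ (-(β : ℤ)) * (|α r t| * (2 * 8 ^ N *
          ((2 : ℝ) ^ (((β : ℤ) - 2) * (N : ℤ)) *
            ∏ l, (((r l).choose (r l / 2 - 1) : ℝ) * Real.sqrt 2 ^ (r l) *
              ((r l : ℝ) + 1) ^ (β + 3))))) := by
        refine Finset.sum_le_sum fun r _ => ?_
        have h1 := sum_abs_chebyshevInsert_sub_quadrature_mul_le hL hS hK hSL' hA r j hv
        have h2 := mul_le_mul_of_nonneg_left (prod_mul_prod_le_redConst_factor β r)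
          (mul_nonneg hA hK0)
        rw [mul_left_comm (A * _)]
        refine mul_le_mul_of_nonneg_left (h1.trans (le_of_eq_of_le ?_ h2)) (abs_nonneg _)
        ring
    _ = _ := by
        rw [redConst, Finset.mul_sum, Finset.mul_sum, Finset.sum_mul]
        refine Finset.sum_congr rfl fun r _ => ?_
        ring
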